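/- Theorem 10.3. For a $d\times d$ integer matrix $A$ let $\mathcal W(A)=A^{d}\mathbb Q^{d}$ be its eventual range and $\mathcal W_0(A)=\mathcal W(A)\cap\mathbb Z^{d}$, a free abelian group of some rank $r$. The dimension group of $A$ is $$G(A)=\{g\in\mathcal W(A) : A^{k}g\in\mathbb Z^{d}\text{ for some }k\ge 0\},$$ ordered by: $g\ge 0$ if and only if $A^{k}g\in(\mathbb Z_{\ge 0})^{d}$ for some $k\ge 0$. (It is the inductive limit of $\mathbb Z^{d}\to\mathbb Z^{d}\to\cdots$ along $A$.) An integer matrix is called primitive if its entries are nonnegative and some positive power of it has only strictly positive entries. Say that $A$ has a positive unimodular cone if, after an identification of $\mathcal W_0(A)$ with $\mathbb Z^{r}$ by a basis, and with $u\in\mathbb R^{r}$ the coordinate vector of a Perron–Frobenius eigenvector of $A$ (an eigenvector with strictly positive entries), there are vectors $w_1,\dots,w_r\in\mathbb Z^{r}$ such that 1. the matrix formed by the $w_i$ has determinant $\pm1$; 2. the convex cone generated by the $w_i$ in $\mathbb R^{r}$ contains an open neighborhood of $u$; 3. every $w_i$, regarded as an element of $\mathcal W_0(A)\subseteq G(A)$,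 is positive in the order of $G(A)$. Let $A$ be a primitive integer matrix, possibly singular, and suppose that $A$ or its transpose $A^{T}$ has a positive unimodular cone. Then there is a primitive integer matrix $B$ with $\det B\neq 0$ such that $G(A)$ and $G(B)$ are isomorphic as ordered groups. -/

import Mathlib

namespace StationaryDimensionGroup

/-- The integer matrix `A`, acting on rational column vectors. -/
abbrev ratMatrix {d : ℕ} (A : Matrix (Fin d) (Fin d) ℤ) : Matrix (Fin d) (Fin d) ℚ :=
  A.map (fun a : ℤ => (a : ℚ))

/-- The eventual range `A ^ d ℚ ^ d` of a `d × d` integer matrix `A`. -/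
def eventualRange {d : ℕ} (A : Matrix (Fin d) (Fin d) ℤ) : Submodule ℚ (Fin d → ℚ) :=
  LinearMap.range ((ratMatrix A ^ d).mulVecLin)

/-- The dimension group of `A` (the inductive limit of `ℤ ^ d → ℤ ^ d → ⋯` along `A`), realized
as the group of vectors `g` in the eventual range such that `A ^ k g` is integral for some `k`. -/
def dimensionGroup {d : ℕ} (A : Matrix (Fin d) (Fin d) ℤ) : AddSubgroup (Fin d → ℚ) where
  carrier := {g | g ∈ eventualRange A ∧
    ∃ (k : ℕ) (m : Fin d → ℤ), (ratMatrix A ^ k).mulVec g = fun i => (m i : ℚ)}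
  zero_mem' := by
    refine ⟨Submodule.zero_mem _, 0, 0, ?_⟩
    ext i
    simp
  neg_mem' := by
    rintro g ⟨hg, k, m, hm⟩
    refine ⟨Submodule.neg_mem _ hg, k, -m, ?_⟩
    rw [Matrix.mulVec_neg, hm]
    ext i
    simp
  add_mem' := by
    rintro g h ⟨hg, k, m, hm⟩ ⟨hh, l, n, hn⟩
    refine ⟨Submodule.add_mem _ hg hh, k + l, (A ^ l).mulVec m + (A ^ k).mulVec n, ?_⟩
    have key : ∀ (p : ℕ) (z : Fin d → ℤ), (ratMatrix A ^ p).mulVec (fun i => (z i : ℚ)) =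
        fun i => (((A ^ p).mulVec z i : ℤ) : ℚ) := by
      intro p z
      have hp : ratMatrix A ^ p = (A ^ p).map (Int.castRingHom ℚ) :=
        (Matrix.map_pow A (Int.castRingHom ℚ) p).symm
      ext i
      rw [hp]
      simp [Matrix.mulVec, dotProduct]
    rw [Matrix.mulVec_add]
    nth_rewrite 1 [add_comm k l]
    rw [pow_add, pow_add, ← Matrix.mulVec_mulVec, ← Matrix.mulVec_mulVec, hm, hn, key, key]
    ext i
    simp

/-- The order of the dimension group: `g ≥ 0` if and only if `A ^ k g` is a vector of nonnegative
integers for some `k`. -/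
def IsNonneg {d : ℕ} (A : Matrix (Fin d) (Fin d) ℤ) (g : dimensionGroup A) : Prop :=
  ∃ (k : ℕ) (m : Fin d → ℕ), (ratMatrix A ^ k).mulVec (g : Fin d → ℚ) = fun i => (m i : ℚ)

/-- The dimension groups of `A` and `B` are isomorphic as ordered groups. -/
def OrderIsomorphic {d n : ℕ} (A : Matrix (Fin d) (Fin d) ℤ) (B : Matrix (Fin n) (Fin n) ℤ) :
    Prop :=
  ∃ e : dimensionGroup A ≃+ dimensionGroup B, ∀ g, IsNonneg A g ↔ IsNonneg B (e g)

/-- The lattice of integer vectors in the eventual range of `A`, a free abelian group. -/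
def eventualLattice {d : ℕ} (A : Matrix (Fin d) (Fin d) ℤ) : Submodule ℤ (Fin d → ℤ) where
  carrier := {z | (fun i => (z i : ℚ)) ∈ eventualRange A}
  zero_mem' := by
    change (fun i => (((0 : Fin d → ℤ) i : ℤ) : ℚ)) ∈ eventualRange A
    have h : (fun i => (((0 : Fin d → ℤ) i : ℤ) : ℚ)) = 0 := by
      ext i
      simp
    rw [h]
    exact Submodule.zero_mem _
  add_mem' := by
    intro y z hy hz
    change (fun i => (((y + z) i : ℤ) : ℚ)) ∈ eventualRange A
    have h : (fun i => (((y + z) i : ℤ) : ℚ)) =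
        (fun i => (y i : ℚ)) + (fun i => (z i : ℚ)) := by
      ext i
      simp
    rw [h]
    exact Submodule.add_mem _ hy hz
  smul_mem' := by
    intro c z hz
    change (fun i => (((c • z) i : ℤ) : ℚ)) ∈ eventualRange A
    have h : (fun i => (((c • z) i : ℤ) : ℚ)) = (c : ℚ) • (fun i => (z i : ℚ)) := by
      ext i
      simp
    rw [h]
    exact Submodule.smul_mem _ _ hz

/-- Integer vectors in the eventual range, as elements of the dimension group. -/
def latticeToDimensionGroup {d : ℕ} (A : Matrix (Fin d) (Fin d) ℤ) (z : eventualLattice A) :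
    dimensionGroup A :=
  ⟨fun i => ((z : Fin d → ℤ) i : ℚ), z.2, 0, (z : Fin d → ℤ), by simp⟩

/-- `v` is a Perron-Frobenius (column) eigenvector of `A`: an eigenvector with strictly positive
entries. For a primitive matrix it is unique up to a positive factor, and its eigenvalue is the
Perron-Frobenius eigenvalue. -/
def IsPerronFrobeniusVector {d : ℕ} (A : Matrix (Fin d) (Fin d) ℤ) (v : Fin d → ℝ) : Prop :=
  (∀ i, 0 < v i) ∧ ∃ t : ℝ, (A.map (fun a : ℤ => (a : ℝ))).mulVec v = t • v

/-- The integer vectors `w 0, …, w (r - 1)` form a matrix of determinant `±1`, and the convex cone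
they generate in `ℝ ^ r` contains an open neighborhood of `u`. -/
def IsUnimodularConeAt {r : ℕ} (u : Fin r → ℝ) (w : Fin r → Fin r → ℤ) : Prop :=
  ((Matrix.of w).det = 1 ∨ (Matrix.of w).det = -1) ∧
    ∃ U : Set (Fin r → ℝ), IsOpen U ∧ u ∈ U ∧
      U ⊆ (PointedCone.hull ℝ (Set.range fun i => fun j => (w i j : ℝ)) : Set (Fin r → ℝ))

/-- After an identification of the lattice of integer vectors in the eventual range of `A` with
`ℤ ^ r` by a basis `x`, there are vectors `w i` in `ℤ ^ r` of determinant `±1` whose cone contains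
a neighborhood of the Perron-Frobenius eigenvector of `A` (with coordinate vector `u`), and such
that all `w i` are positive in the dimension group of `A`. -/
def HasPositiveUnimodularCone {d : ℕ} (A : Matrix (Fin d) (Fin d) ℤ) : Prop :=
  ∃ (r : ℕ) (x : Module.Basis (Fin r) ℤ (eventualLattice A)) (u : Fin r → ℝ)
    (w : Fin r → Fin r → ℤ),
    IsPerronFrobeniusVector A (fun i => ∑ j, u j * ((x j : Fin d → ℤ) i : ℝ)) ∧
    IsUnimodularConeAt u w ∧
    ∀ i, IsNonneg A (latticeToDimensionGroup A (∑ j, w i j • x j))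

end StationaryDimensionGroup

/-! Suppose `A` itself has the cone. The unimodular vectors form a lattice basis of the integer
points of the eventual range: the columns of `X`, with integral left inverse `Y`. In this basis `A`
acts by `Y * A * X`, which is nonsingular because `A` is injective on its eventual range. The Perron
vector lies in the interior of the cone, so its coordinates `c` are positive. Iterates of a nonzero
positive element converge in direction to the Perron vector, so their coordinates become positive
(`eventually_pos`). Applied to the basis vectors, which are positive in `G(A)`, this gives a
strictly positive power `B = (Y * A * X) ^ N`, and multiplication by `X` identifies `G(B)` with
`G(A)`. The order matches because positivity in `G(A)` forces eventual positivity of coordinates,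
and conversely some `A ^ K * X` is nonnegative.

If the cone belongs to `Aᵀ`, the same construction is transposed: `Xᵀ` maps `G(A)` to `G(B)`. Now `X
c` is a left Perron vector of `A`, and an integer vector pairing positively with it is eventually
positive under `A`. -/

namespace StationaryDimensionGroup

open Filter Topology Matrix

/-! ### Perron–Frobenius convergence for primitive real matrices -/

section Perron

variable {ι : Type*} [Fintype ι]

lemma const_le_mulVec_of_stochastic {Q : Matrix ι ι ℝ} (hQ : ∀ i j, 0 ≤ Q i j)
    (hQ1 : ∀ i, ∑ j, Q i j = 1) {f : ι → ℝ} {a : ℝ} (ha : ∀ j, a ≤ f j) (i : ι) :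
    a ≤ (Q *ᵥ f) i := by
  calc a = ∑ j, Q i j * a := by rw [← Finset.sum_mul, hQ1, one_mul]
    _ ≤ ∑ j, Q i j * f j :=
      Finset.sum_le_sum fun j _ => mul_le_mul_of_nonneg_left (ha j) (hQ i j)

/-- The gap `b - (Q *ᵥ f) i` is an average of the nonnegative gaps `b - f j`, in which `j₀` has
weight at least `δ`. -/
lemma mulVec_le_of_stochastic {Q : Matrix ι ι ℝ} (hQ1 : ∀ i, ∑ j, Q i j = 1) {δ : ℝ}
    (hδ0 : 0 ≤ δ) (hδ : ∀ i j, δ ≤ Q i j) {f : ι → ℝ} {b : ℝ} (hb : ∀ j, f j ≤ b) (j₀ i : ι) :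
    (Q *ᵥ f) i ≤ b - δ * (b - f j₀) := by
  have h1 : b - (Q *ᵥ f) i = ∑ j, Q i j * (b - f j) := by
    simp only [mul_sub, Finset.sum_sub_distrib, ← Finset.sum_mul, hQ1, one_mul]
    rfl
  have h2 : Q i j₀ * (b - f j₀) ≤ ∑ j, Q i j * (b - f j) :=
    Finset.single_le_sum (f := fun j => Q i j * (b - f j))
      (fun j _ => mul_nonneg (hδ0.trans (hδ i j)) (sub_nonneg.2 (hb j))) (Finset.mem_univ j₀)
  have h3 : δ * (b - f j₀) ≤ Q i j₀ * (b - f j₀) :=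
    mul_le_mul_of_nonneg_right (hδ i j₀) (sub_nonneg.2 (hb j₀))
  linarith

variable [DecidableEq ι]

lemma pow_apply_nonneg {R : Type*} [Semiring R] [PartialOrder R] [IsOrderedRing R]
    {P : Matrix ι ι R} (hP : ∀ i j, 0 ≤ P i j) (n : ℕ) (i j : ι) : 0 ≤ (P ^ n) i j := by
  induction n generalizing i j with
  | zero =>
    rw [pow_zero, Matrix.one_apply]
    split_ifs
    · exact zero_le_one
    · exact le_rfl
  | succ n ih =>
    rw [pow_succ, Matrix.mul_apply]
    exact Finset.sum_nonneg fun k _ => mul_nonneg (ih i k) (hP k j)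

lemma pow_mulVec_eigenvector {R : Type*} [CommSemiring R] {M : Matrix ι ι R} {v : ι → R} {t : R}
    (h : M *ᵥ v = t • v) (n : ℕ) : M ^ n *ᵥ v = t ^ n • v := by
  induction n with
  | zero => simp
  | succ n ih => rw [pow_succ, ← mulVec_mulVec, h, mulVec_smul, ih, smul_smul, pow_succ, mul_comm]

/-- The powers of a primitive stochastic matrix, applied to a nonzero nonnegative vector, converge
to a positive constant vector. -/
theorem exists_tendsto_pow_mulVec_of_stochastic {P : Matrix ι ι ℝ} (hP : ∀ i j, 0 ≤ P i j)
    (hP1 : ∀ i, ∑ j, P i j = 1) {K : ℕ} (hK : ∀ i j, 0 < (P ^ K) i j)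
    {f : ι → ℝ} (hf : ∀ i, 0 ≤ f i) (hf0 : f ≠ 0) :
    ∃ c > 0, ∀ i, Tendsto (fun n => (P ^ n *ᵥ f) i) atTop (𝓝 c) := by
  obtain ⟨i₀, hi₀⟩ := Function.ne_iff.1 hf0
  have : Nonempty ι := ⟨i₀⟩
  have hPn1 : ∀ n i, ∑ j, (P ^ n) i j = 1 := by
    have h1 : P *ᵥ (fun _ => (1 : ℝ)) = (1 : ℝ) • fun _ => (1 : ℝ) := by
      ext i
      simp [mulVec, dotProduct, hP1]
    intro n i
    have h2 := congrFun (pow_mulVec_eigenvector h1 n) i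
    simpa [mulVec, dotProduct] using h2
  obtain ⟨p, hp⟩ := Finite.exists_min fun p : ι × ι => (P ^ K) p.1 p.2
  set δ := (P ^ K) p.1 p.2 with hδ
  have hδ0 : 0 < δ := hK _ _
  have hδle : ∀ i j, δ ≤ (P ^ K) i j := fun i j => hp (i, j)
  have hδ1 : δ ≤ 1 := by
    rw [← hPn1 K p.1]
    exact Finset.single_le_sum (f := fun j => (P ^ K) p.1 j)
      (fun j _ => (hK p.1 j).le) (Finset.mem_univ p.2)
  set a : ℕ → ℝ := fun n => Finset.univ.inf' Finset.univ_nonempty (P ^ n *ᵥ f) with ha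
  set b : ℕ → ℝ := fun n => Finset.univ.sup' Finset.univ_nonempty (P ^ n *ᵥ f) with hb
  have hale : ∀ n i, a n ≤ (P ^ n *ᵥ f) i := fun n i => Finset.inf'_le _ (Finset.mem_univ i)
  have hleb : ∀ n i, (P ^ n *ᵥ f) i ≤ b n := fun n i => Finset.le_sup' _ (Finset.mem_univ i)
  have hab : ∀ n, a n ≤ b n := fun n => (hale n i₀).trans (hleb n i₀)
  have hstep : ∀ m n, P ^ (n + m) *ᵥ f = P ^ m *ᵥ (P ^ n *ᵥ f) := fun m n => by
    rw [mulVec_mulVec, ← pow_add, add_comm]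
  have hamono : Monotone a := by
    intro n n' hn
    obtain ⟨m, rfl⟩ := Nat.exists_eq_add_of_le hn
    refine Finset.le_inf' _ _ fun i _ => ?_
    rw [hstep]
    exact const_le_mulVec_of_stochastic (pow_apply_nonneg hP m) (hPn1 m) (hale n) i
  have hbanti : Antitone b := by
    intro n n' hn
    obtain ⟨m, rfl⟩ := Nat.exists_eq_add_of_le hn
    refine Finset.sup'_le _ _ fun i _ => ?_
    rw [hstep]
    have := mulVec_le_of_stochastic (hPn1 m) le_rfl (pow_apply_nonneg hP m) (hleb n) i i
    linarith
  -- With `j₀` a point where the minimum is attained, each row of `P ^ K` gives it weight at least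
  -- `δ`. So the oscillation shrinks by the factor `1 - δ` every `K` steps.
  have hcontr : ∀ n, b (n + K) - a (n + K) ≤ (1 - δ) * (b n - a n) := by
    intro n
    obtain ⟨j₀, -, hj₀⟩ := Finset.exists_mem_eq_inf' Finset.univ_nonempty (P ^ n *ᵥ f)
    have h1 : b (n + K) ≤ b n - δ * (b n - a n) := by
      refine Finset.sup'_le _ _ fun i _ => ?_
      rw [hstep]
      have := mulVec_le_of_stochastic (hPn1 K) hδ0.le hδle (hleb n) j₀ i
      rwa [← hj₀] at this
    have h2 : a n ≤ a (n + K) := hamono (Nat.le_add_right _ _)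
    linarith
  have ha_lim := tendsto_atTop_ciSup hamono
    ⟨b 0, by rintro _ ⟨n, rfl⟩; exact (hab n).trans (hbanti (Nat.zero_le n))⟩
  have hb_lim := tendsto_atTop_ciInf hbanti
    ⟨a 0, by rintro _ ⟨n, rfl⟩; exact (hamono (Nat.zero_le n)).trans (hab n)⟩
  set α := ⨆ n, a n
  set β := ⨅ n, b n
  have hsub := hb_lim.sub ha_lim
  have hle : β - α ≤ (1 - δ) * (β - α) :=
    le_of_tendsto_of_tendsto' ((tendsto_add_atTop_iff_nat K).2 hsub) (hsub.const_mul (1 - δ)) hcontr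
  have hge : α ≤ β := le_of_tendsto_of_tendsto' ha_lim hb_lim hab
  have heq : β = α := by nlinarith
  refine ⟨α, ?_, fun i => tendsto_of_tendsto_of_tendsto_of_le_of_le ha_lim (heq ▸ hb_lim)
    (fun n => hale n i) (fun n => hleb n i)⟩
  -- The minima increase to the limit, so one positive minimum suffices.
  have haK : 0 < a K := by
    rw [ha, Finset.lt_inf'_iff]
    intro i _
    refine Finset.sum_pos' (fun j _ => mul_nonneg (hK i j).le (hf j)) ⟨i₀, Finset.mem_univ _, ?_⟩
    exact mul_pos (hK i i₀) (lt_of_le_of_ne (hf i₀) (Ne.symm hi₀))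
  exact haK.trans_le (hamono.ge_of_tendsto ha_lim K)

/-- If `t = 0`, then `M ^ K *ᵥ v = 0` since `K > 0`, although both `M ^ K` and `v` are positive. -/
lemma eigenvalue_pos {M : Matrix ι ι ℝ} (hM : ∀ i j, 0 ≤ M i j) {K : ℕ}
    (hK : ∀ i j, 0 < (M ^ K) i j) (hK0 : 0 < K) {v : ι → ℝ} (hv : ∀ i, 0 < v i) {t : ℝ}
    (h : M *ᵥ v = t • v) (i : ι) : 0 < t := by
  have h1 : 0 ≤ t * v i := by
    have := congrFun h i
    rw [Pi.smul_apply, smul_eq_mul] at this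
    rw [← this]
    exact Finset.sum_nonneg fun j _ => mul_nonneg (hM i j) (hv j).le
  refine lt_of_le_of_ne (nonneg_of_mul_nonneg_left h1 (hv i)) fun h0 => ?_
  have h2 := congrFun (pow_mulVec_eigenvector h K) i
  rw [← h0, zero_pow hK0.ne', zero_smul] at h2
  exact (Finset.sum_pos (fun j _ => mul_pos (hK i j) (hv j)) ⟨i, Finset.mem_univ i⟩).ne' h2

/-- Perron-Frobenius convergence: the normalized iterates of a nonzero nonnegative vector under a
primitive matrix converge to a positive multiple of the positive eigenvector. -/
theorem exists_tendsto_pow_mulVec {M : Matrix ι ι ℝ} (hM : ∀ i j, 0 ≤ M i j) {K : ℕ}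
    (hK : ∀ i j, 0 < (M ^ K) i j) {v : ι → ℝ} (hv : ∀ i, 0 < v i) {t : ℝ} (ht : 0 < t)
    (h : M *ᵥ v = t • v) {z : ι → ℝ} (hz : ∀ i, 0 ≤ z i) (hz0 : z ≠ 0) :
    ∃ c > 0, ∀ i, Tendsto (fun n => (t ^ n)⁻¹ * (M ^ n *ᵥ z) i) atTop (𝓝 (c * v i)) := by
  -- Conjugating `M / t` by the diagonal matrix of `v` gives row sums `1`, because `M *ᵥ v = t • v`.
  set P : Matrix ι ι ℝ := Matrix.of fun i j => M i j * v j / (t * v i) with hPdef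
  have hPn : ∀ n i j, (P ^ n) i j = (M ^ n) i j * v j / (t ^ n * v i) := by
    intro n
    induction n with
    | zero =>
      intro i j
      by_cases hij : i = j
      · subst hij
        simp [(hv i).ne']
      · simp [hij]
    | succ n ih =>
      intro i j
      rw [pow_succ, Matrix.mul_apply, pow_succ, Matrix.mul_apply, Finset.sum_mul, Finset.sum_div]
      refine Finset.sum_congr rfl fun k _ => ?_
      rw [ih, hPdef, Matrix.of_apply]
      have := hv i
      have := hv k
      field_simp
      ring
  have hPf : ∀ n i, (P ^ n *ᵥ fun j => z j / v j) i = (t ^ n)⁻¹ * (M ^ n *ᵥ z) i / v i := by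
    intro n i
    simp only [mulVec, dotProduct, hPn, Finset.mul_sum, Finset.sum_div]
    refine Finset.sum_congr rfl fun k _ => ?_
    have := hv i
    have := hv k
    field_simp
  obtain ⟨c, hc, hlim⟩ := exists_tendsto_pow_mulVec_of_stochastic (P := P) (K := K)
    (f := fun j => z j / v j)
    (fun i j => div_nonneg (mul_nonneg (hM i j) (hv j).le) (mul_pos ht (hv i)).le)
    (fun i => by
      have h1 := congrFun h i
      simp only [mulVec, dotProduct, Pi.smul_apply, smul_eq_mul] at h1
      simp only [hPdef, Matrix.of_apply, ← Finset.sum_div, h1]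
      exact div_self (mul_pos ht (hv i)).ne')
    (fun i j => by
      rw [hPn]
      exact div_pos (mul_pos (hK i j) (hv j)) (mul_pos (pow_pos ht K) (hv i)))
    (fun i => div_nonneg (hz i) (hv i).le)
    (fun h0 => hz0 <| funext fun i => by
      have h1 := congrFun h0 i
      simpa [(hv i).ne'] using h1)
  refine ⟨c, hc, fun i => ?_⟩
  have h1 := (hlim i).mul_const (v i)
  refine h1.congr fun n => ?_
  rw [hPf, div_mul_cancel₀ _ (hv i).ne']

end Perron

/-! ### Integer matrices over other rings, and intertwining relations -/

section Cast

variable {l m n : Type*}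

lemma map_intCast_one (R : Type*) [CommRing R] [DecidableEq n] :
    (1 : Matrix n n ℤ).map (fun a : ℤ => (a : R)) = 1 := by
  ext i j
  by_cases h : i = j <;> simp [Matrix.one_apply, h]

variable [Fintype n]

lemma map_intCast_mulVec (R : Type*) [CommRing R] (X : Matrix m n ℤ) (z : n → ℤ) :
    X.map (fun a : ℤ => (a : R)) *ᵥ (fun i => (z i : R)) = fun i => ((X *ᵥ z) i : R) := by
  ext i
  simp [mulVec, dotProduct]

lemma map_intCast_mul (R : Type*) [CommRing R] (X : Matrix m n ℤ) (Y : Matrix n l ℤ) :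
    (X * Y).map (fun a : ℤ => (a : R)) =
      X.map (fun a : ℤ => (a : R)) * Y.map (fun a : ℤ => (a : R)) := by
  ext i j
  simp [Matrix.mul_apply]

lemma map_intCast_pow (R : Type*) [CommRing R] [DecidableEq n] (A : Matrix n n ℤ) (k : ℕ) :
    (A ^ k).map (fun a : ℤ => (a : R)) = A.map (fun a : ℤ => (a : R)) ^ k := by
  induction k with
  | zero => rw [pow_zero, pow_zero, map_intCast_one]
  | succ k ih => rw [pow_succ, pow_succ, map_intCast_mul, ih]

lemma pow_mul_eq_mul_pow {R : Type*} [CommRing R] [DecidableEq n] [Fintype m] [DecidableEq m]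
    {A : Matrix m m R} {X : Matrix m n R} {B : Matrix n n R} (h : A * X = X * B) (k : ℕ) :
    A ^ k * X = X * B ^ k := by
  induction k with
  | zero => simp
  | succ k ih => rw [pow_succ, Matrix.mul_assoc, h, ← Matrix.mul_assoc, ih, Matrix.mul_assoc,
      ← pow_succ]

lemma mulVec_nonneg {R : Type*} [Semiring R] [PartialOrder R] [IsOrderedRing R]
    {M : Matrix m n R} (hM : ∀ i j, 0 ≤ M i j) {v : n → R} (hv : ∀ j, 0 ≤ v j) (i : m) :
    0 ≤ (M *ᵥ v) i :=
  Finset.sum_nonneg fun j _ => mul_nonneg (hM i j) (hv j)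

end Cast

/-! ### The eventual range and its lattice -/

section EventualRange

variable {d : ℕ} {A : Matrix (Fin d) (Fin d) ℤ}

lemma pow_mulVec_mem_eventualRange (q : Fin d → ℚ) :
    ratMatrix A ^ d *ᵥ q ∈ eventualRange A :=
  ⟨q, rfl⟩

lemma mulVec_mem_eventualRange {g : Fin d → ℚ} (hg : g ∈ eventualRange A) (k : ℕ) :
    ratMatrix A ^ k *ᵥ g ∈ eventualRange A := by
  obtain ⟨q, rfl⟩ := hg
  refine ⟨ratMatrix A ^ k *ᵥ q, ?_⟩
  simp only [mulVecLin_apply, mulVec_mulVec, ← pow_add, add_comm]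

/-- Kernels of powers stabilize by exponent `d`: if `A ^ (k + d)` kills `q`, so does `A ^ d`. -/
lemma eq_zero_of_pow_mulVec_eq_zero {g : Fin d → ℚ} (hg : g ∈ eventualRange A) {k : ℕ}
    (h : ratMatrix A ^ k *ᵥ g = 0) : g = 0 := by
  obtain ⟨q, rfl⟩ := hg
  have hpow : ∀ (n : ℕ) (x : Fin d → ℚ),
      ((toLin' (ratMatrix A) : Module.End ℚ (Fin d → ℚ)) ^ n) x = ratMatrix A ^ n *ᵥ x := by
    intro n x
    rw [← toLin'_pow, toLin'_apply]
  have h1 := Module.End.ker_pow_le_ker_pow_finrank (toLin' (ratMatrix A)) (k + d)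
  rw [Module.finrank_fin_fun] at h1
  have h2 : q ∈ LinearMap.ker ((toLin' (ratMatrix A) : Module.End ℚ (Fin d → ℚ)) ^ (k + d)) := by
    rw [LinearMap.mem_ker, hpow, pow_add, ← mulVec_mulVec]
    exact h
  have h3 := h1 h2
  rw [LinearMap.mem_ker, hpow] at h3
  exact h3

lemma pow_mulVec_mem_eventualLattice (z : Fin d → ℤ) : A ^ d *ᵥ z ∈ eventualLattice A := by
  change (fun i => ((A ^ d *ᵥ z) i : ℚ)) ∈ eventualRange A
  rw [← map_intCast_mulVec, map_intCast_pow]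
  exact pow_mulVec_mem_eventualRange _

lemma mulVec_mem_eventualLattice {z : Fin d → ℤ} (hz : z ∈ eventualLattice A) :
    A *ᵥ z ∈ eventualLattice A := by
  change (fun i => ((A *ᵥ z) i : ℚ)) ∈ eventualRange A
  have h := mulVec_mem_eventualRange (A := A) hz 1
  rwa [pow_one, map_intCast_mulVec] at h

/-- The lattice of integer vectors in the eventual range is a direct summand of `ℤ ^ d`. -/
lemma exists_projection_eventualLattice (A : Matrix (Fin d) (Fin d) ℤ) :
    ∃ p : (Fin d → ℤ) →ₗ[ℤ] eventualLattice A, ∀ z : eventualLattice A, p z = z := by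
  -- The lattice is cut out by a rational subspace, so the quotient is torsion-free, hence free, and
  -- the quotient map splits.
  have htf : Module.IsTorsionFree ℤ ((Fin d → ℤ) ⧸ eventualLattice A) := by
    refine Module.IsTorsionFree.of_smul_eq_zero fun a x h => ?_
    obtain ⟨z, rfl⟩ := Submodule.mkQ_surjective _ x
    by_cases ha : a = 0
    · exact Or.inl ha
    · right
      rw [← map_smul, Submodule.mkQ_apply, Submodule.Quotient.mk_eq_zero] at h
      rw [Submodule.mkQ_apply, Submodule.Quotient.mk_eq_zero]
      have h1 := (eventualRange A).smul_mem (a : ℚ)⁻¹ h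
      change (fun i => (z i : ℚ)) ∈ eventualRange A
      convert h1 using 1
      ext i
      simp [ha]
  have : Module.Free ℤ ((Fin d → ℤ) ⧸ eventualLattice A) := inferInstance
  obtain ⟨s, hs⟩ := Module.projective_lifting_property (eventualLattice A).mkQ LinearMap.id
    (Submodule.mkQ_surjective _)
  refine ⟨LinearMap.codRestrict _ (LinearMap.id - s ∘ₗ (eventualLattice A).mkQ) fun z => ?_,
    fun z => ?_⟩
  · rw [← Submodule.Quotient.mk_eq_zero, ← Submodule.mkQ_apply]
    have h1 := LinearMap.congr_fun hs ((eventualLattice A).mkQ z)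
    simp only [LinearMap.comp_apply, LinearMap.id_apply] at h1
    simp [-Submodule.mkQ_apply, h1]
  · ext1
    have h1 : (eventualLattice A).mkQ z = 0 := by simp
    rw [LinearMap.codRestrict_apply, LinearMap.sub_apply, LinearMap.comp_apply, h1]
    simp

end EventualRange

/-! ### Positive frames from unimodular cones -/

/-- A basis of the lattice of integer vectors in the eventual range of `A` (the columns of `X`,
with a left inverse `Y`), consisting of vectors that are positive in the dimension group, together
with the coordinates `c > 0` of a Perron-Frobenius eigenvector. -/
structure IsPositiveFrame {d r : ℕ} (A : Matrix (Fin d) (Fin d) ℤ) (X : Matrix (Fin d) (Fin r) ℤ)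
    (Y : Matrix (Fin r) (Fin d) ℤ) (c : Fin r → ℝ) : Prop where
  left_inv : Y * X = 1
  mem : ∀ m, X *ᵥ m ∈ eventualLattice A
  right_inv : ∀ z ∈ eventualLattice A, X *ᵥ (Y *ᵥ z) = z
  coeff_pos : ∀ l, 0 < c l
  perron : IsPerronFrobeniusVector A (X.map (fun a : ℤ => (a : ℝ)) *ᵥ c)
  nonneg : ∀ l, ∃ k : ℕ, ∀ i, 0 ≤ (A ^ k * X) i l

/-- For small `ε > 0`, subtracting `ε` times the sum of the generators keeps `u` in the cone. Adding
it back raises every coefficient by `ε`. -/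
lemma exists_pos_coeff_of_isUnimodularConeAt {r : ℕ} {u : Fin r → ℝ} {w : Fin r → Fin r → ℤ}
    (h : IsUnimodularConeAt u w) :
    ∃ c : Fin r → ℝ, (∀ l, 0 < c l) ∧ ∀ j, u j = ∑ l, c l * (w l j : ℝ) := by
  obtain ⟨-, U, hU, hu, hsub⟩ := h
  set s : Fin r → ℝ := fun j => ∑ l, (w l j : ℝ) with hs
  have hcont : Continuous fun ε : ℝ => u - ε • s := by fun_prop
  have hev : ∀ᶠ ε : ℝ in 𝓝 0, u - ε • s ∈ U :=
    hcont.continuousAt.eventually_mem (hU.mem_nhds (by simpa using hu))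
  obtain ⟨ε, hε, hε0⟩ :=
    ((hev.filter_mono nhdsWithin_le_nhds).and (self_mem_nhdsWithin (s := Set.Ioi (0 : ℝ)))).exists
  obtain ⟨a, ha⟩ := (Submodule.mem_span_range_iff_exists_fun _).1 (hsub hε)
  refine ⟨fun l => a l + ε, fun l => add_pos_of_nonneg_of_pos (a l).2 hε0, fun j => ?_⟩
  have h1 := congrFun ha j
  simp only [Finset.sum_apply, Pi.smul_apply, Pi.sub_apply, smul_eq_mul, hs] at h1
  have h2 : ∑ l, (a l : ℝ) * (w l j : ℝ) = u j - ε * ∑ l, (w l j : ℝ) := h1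
  simp only [add_mul, Finset.sum_add_distrib, ← Finset.mul_sum, h2]
  ring

/-- A positive unimodular cone gives a positive frame. -/
lemma HasPositiveUnimodularCone.exists_isPositiveFrame {d : ℕ} {A : Matrix (Fin d) (Fin d) ℤ}
    (h : HasPositiveUnimodularCone A) :
    ∃ (r : ℕ) (X : Matrix (Fin d) (Fin r) ℤ) (Y : Matrix (Fin r) (Fin d) ℤ) (c : Fin r → ℝ),
      IsPositiveFrame A X Y c := by
  obtain ⟨r, x, u, w, hpf, hw, hpos⟩ := h
  obtain ⟨c, hc, hcu⟩ := exists_pos_coeff_of_isUnimodularConeAt hw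
  obtain ⟨p, hp⟩ := exists_projection_eventualLattice A
  have hdet : IsUnit (Matrix.of w)ᵀ.det := by
    rw [det_transpose, Int.isUnit_iff]
    exact hw.1
  set X₀ : Matrix (Fin d) (Fin r) ℤ := Matrix.of fun i j => (x j : Fin d → ℤ) i with hX₀
  set Y₀ : Matrix (Fin r) (Fin d) ℤ := LinearMap.toMatrix' (x.equivFun.toLinearMap ∘ₗ p) with hY₀
  have hXm : ∀ m, X₀ *ᵥ m = ((∑ j, m j • x j : eventualLattice A) : Fin d → ℤ) := by
    intro m
    ext i
    simp [hX₀, mulVec, dotProduct, mul_comm]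
  have hYz : ∀ z : eventualLattice A, Y₀ *ᵥ (z : Fin d → ℤ) = x.equivFun z := by
    intro z
    rw [hY₀, LinearMap.toMatrix'_mulVec]
    simp [hp]
  have hYX : Y₀ * X₀ = 1 := by
    refine ext_of_mulVec_single fun j => ?_
    rw [← mulVec_mulVec, hXm, hYz, ← x.equivFun_symm_apply, LinearEquiv.apply_symm_apply,
      one_mulVec]
  have hXY : ∀ z ∈ eventualLattice A, X₀ *ᵥ (Y₀ *ᵥ z) = z := by
    intro z hz
    have h1 := hYz ⟨z, hz⟩
    simp only at h1
    rw [h1, hXm, x.sum_equivFun]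
  -- Determinant `±1` makes the inverse integral, so the vectors `w l` again form a basis of the
  -- lattice.
  refine ⟨r, X₀ * (Matrix.of w)ᵀ, (Matrix.of w)ᵀ⁻¹ * Y₀, c, ?_, ?_, ?_, hc, ?_, ?_⟩
  · rw [Matrix.mul_assoc, ← Matrix.mul_assoc Y₀, hYX, Matrix.one_mul, nonsing_inv_mul _ hdet]
  · intro m
    rw [← mulVec_mulVec, hXm]
    exact Subtype.property _
  · intro z hz
    rw [← mulVec_mulVec, mulVec_mulVec _ (Matrix.of w)ᵀ, ← Matrix.mul_assoc,
      mul_nonsing_inv _ hdet, Matrix.one_mul, hXY z hz]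
  · convert hpf using 1
    ext i
    have hu : ((Matrix.of w)ᵀ.map fun a : ℤ => (a : ℝ)) *ᵥ c = u := by
      ext j
      simp [mulVec, dotProduct, hcu, mul_comm]
    rw [map_intCast_mul, ← mulVec_mulVec, hu]
    simp [mulVec, dotProduct, hX₀, mul_comm]
  · intro l
    obtain ⟨k, m, hm⟩ := hpos l
    refine ⟨k, fun i => ?_⟩
    have h1 : (A ^ k * (X₀ * (Matrix.of w)ᵀ)) i l =
        (A ^ k *ᵥ ((∑ j, w l j • x j : eventualLattice A) : Fin d → ℤ)) i := by
      rw [← hXm, mulVec_mulVec, ← Matrix.mul_assoc]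
      rfl
    have h2 := congrFun hm i
    change (ratMatrix A ^ k *ᵥ fun i =>
      (((∑ j, w l j • x j : eventualLattice A) : Fin d → ℤ) i : ℚ)) i = _ at h2
    rw [← map_intCast_pow, map_intCast_mulVec] at h2
    rw [h1, ← Int.cast_nonneg_iff (R := ℚ)]
    exact h2.ge.trans' (Nat.cast_nonneg _)

section Casts

variable {d : ℕ} {A : Matrix (Fin d) (Fin d) ℤ}

lemma ratMatrix_pow (A : Matrix (Fin d) (Fin d) ℤ) (k : ℕ) :
    ratMatrix (A ^ k) = ratMatrix A ^ k :=
  map_intCast_pow ℚ A k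

lemma intCast_comp_injective {z z' : Fin d → ℤ}
    (h : (fun i => (z i : ℚ)) = fun i => (z' i : ℚ)) : z = z' := by
  ext i
  exact_mod_cast congrFun h i

lemma ratMatrix_pow_mulVec_intCast (A : Matrix (Fin d) (Fin d) ℤ) (k : ℕ) (z : Fin d → ℤ) :
    ratMatrix A ^ k *ᵥ (fun i => (z i : ℚ)) = fun i => ((A ^ k *ᵥ z) i : ℚ) := by
  rw [← ratMatrix_pow, map_intCast_mulVec]

lemma ratMatrix_pow_mulVec_of_le {g : Fin d → ℚ} {k n : ℕ} {z : Fin d → ℤ}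
    (h : ratMatrix A ^ k *ᵥ g = fun i => (z i : ℚ)) (hkn : k ≤ n) :
    ratMatrix A ^ n *ᵥ g = fun i => ((A ^ (n - k) *ᵥ z) i : ℚ) := by
  rw [← ratMatrix_pow_mulVec_intCast, ← h, mulVec_mulVec, ← pow_add, Nat.sub_add_cancel hkn]

lemma isNonneg_iff {g : dimensionGroup A} :
    IsNonneg A g ↔ ∃ (k : ℕ) (z : Fin d → ℤ), (∀ i, 0 ≤ z i) ∧
      ratMatrix A ^ k *ᵥ (g : Fin d → ℚ) = fun i => (z i : ℚ) := by
  constructor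
  · rintro ⟨k, m, h⟩
    exact ⟨k, fun i => m i, fun i => Int.natCast_nonneg _, by simpa using h⟩
  · rintro ⟨k, z, hz, h⟩
    refine ⟨k, fun i => (z i).toNat, h.trans (funext fun i => ?_)⟩
    have h1 := Int.toNat_of_nonneg (hz i)
    exact_mod_cast h1.symm

lemma isUnit_det_ratMatrix_pow (hA : A.det ≠ 0) (k : ℕ) : IsUnit (ratMatrix A ^ k).det := by
  rw [det_pow]
  refine IsUnit.pow _ (isUnit_iff_ne_zero.2 ?_)
  have h1 : (ratMatrix A).det = (A.det : ℚ) := (RingHom.map_det (Int.castRingHom ℚ) A).symm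
  rw [h1]
  exact_mod_cast hA

lemma exists_pow_mulVec_eq (hA : A.det ≠ 0) (k : ℕ) (g : Fin d → ℚ) :
    ∃ h, ratMatrix A ^ k *ᵥ h = g :=
  ⟨(ratMatrix A ^ k)⁻¹ *ᵥ g, by
    rw [mulVec_mulVec, mul_nonsing_inv _ (isUnit_det_ratMatrix_pow hA k), one_mulVec]⟩

lemma mem_eventualRange_of_det_ne_zero (hA : A.det ≠ 0) (g : Fin d → ℚ) :
    g ∈ eventualRange A :=
  exists_pow_mulVec_eq hA d g

end Casts

/-! ### Eventual positivity of integer vectors -/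

section IntegerPerron

variable {d : ℕ} {A : Matrix (Fin d) (Fin d) ℤ}

lemma exists_tendsto_pow_mulVec_intCast (hA : A.IsPrimitive) {v : Fin d → ℝ}
    (hv : IsPerronFrobeniusVector A v) {z : Fin d → ℤ} (hz : ∀ i, 0 ≤ z i) (hz0 : z ≠ 0) :
    ∃ t > 0, ∃ c > 0, ∀ i,
      Tendsto (fun n => (t ^ n)⁻¹ * ((A ^ n *ᵥ z) i : ℝ)) atTop (𝓝 (c * v i)) := by
  obtain ⟨i₀, hi₀⟩ := Function.ne_iff.1 hz0
  obtain ⟨hvpos, t, ht⟩ := hv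
  obtain ⟨K, hK0, hK⟩ := hA.exists_pos_pow
  have hM : ∀ i j, 0 ≤ A.map (fun a : ℤ => (a : ℝ)) i j := fun i j =>
    Int.cast_nonneg (hA.nonneg i j)
  have hMK : ∀ i j, 0 < (A.map (fun a : ℤ => (a : ℝ)) ^ K) i j := fun i j => by
    rw [← map_intCast_pow]
    exact Int.cast_pos.2 (hK i j)
  have htpos := eigenvalue_pos hM hMK hK0 hvpos ht i₀
  obtain ⟨c, hc, hlim⟩ := exists_tendsto_pow_mulVec hM hMK hvpos htpos ht
    (z := fun i => (z i : ℝ)) (fun i => Int.cast_nonneg (hz i))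
    (Function.ne_iff.2 ⟨i₀, Int.cast_ne_zero.2 hi₀⟩)
  refine ⟨t, htpos, c, hc, fun i => (hlim i).congr fun n => ?_⟩
  rw [← map_intCast_pow, map_intCast_mulVec]

lemma eventually_pos_of_tendsto {t : ℝ} (ht : 0 < t) {x : ℕ → ℤ} {a : ℝ} (ha : 0 < a)
    (h : Tendsto (fun n => (t ^ n)⁻¹ * (x n : ℝ)) atTop (𝓝 a)) : ∀ᶠ n in atTop, 0 < x n := by
  filter_upwards [h.eventually (lt_mem_nhds ha)] with n hn
  exact Int.cast_pos.1 (pos_of_mul_pos_right hn (inv_nonneg.2 (pow_nonneg ht.le n)))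

lemma isPrimitive_transpose (hA : A.IsPrimitive) : Aᵀ.IsPrimitive := by
  obtain ⟨k, hk0, hk⟩ := hA.exists_pos_pow
  exact ⟨fun i j => hA.nonneg j i, k, hk0, fun i j => by
    rw [← transpose_pow]
    exact hk j i⟩

/-- Integer vectors on which a left Perron-Frobenius eigenvector is positive are eventually
positive. -/
lemma eventually_pos_pow_mulVec (hA : A.IsPrimitive) {v : Fin d → ℝ}
    (hv : IsPerronFrobeniusVector Aᵀ v) {z : Fin d → ℤ} (hz : 0 < ∑ j, v j * (z j : ℝ)) :
    ∀ᶠ n in atTop, ∀ i, 0 < (A ^ n *ᵥ z) i := by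
  refine eventually_all.2 fun i => ?_
  -- Row `i` of `A ^ n` is `Aᵀ ^ n` applied to the `i`-th unit vector, so it is asymptotic to a
  -- positive multiple of `t ^ n • v`.
  obtain ⟨t, ht, c, hc, hlim⟩ := exists_tendsto_pow_mulVec_intCast (isPrimitive_transpose hA) hv
    (z := Pi.single i 1) (Pi.single_nonneg.2 (zero_le_one' ℤ) : (0 : Fin d → ℤ) ≤ Pi.single i 1)
    (Pi.single_ne_zero_iff.2 one_ne_zero)
  refine eventually_pos_of_tendsto ht (mul_pos hc hz) ?_
  have h1 := tendsto_finsetSum Finset.univ fun j _ => (hlim j).mul_const (z j : ℝ)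
  have h2 : ∑ j, c * v j * (z j : ℝ) = c * ∑ j, v j * (z j : ℝ) := by
    rw [Finset.mul_sum]
    exact Finset.sum_congr rfl fun j _ => mul_assoc _ _ _
  rw [h2] at h1
  refine h1.congr fun n => ?_
  simp only [← transpose_pow, mulVec_single_one, mul_assoc, ← Finset.mul_sum]
  congr 1
  simp only [mulVec, dotProduct, Int.cast_sum, Int.cast_mul, col_apply, transpose_apply]

end IntegerPerron

/-! ### The action of the matrix in frame coordinates -/

namespace IsPositiveFrame

variable {d r : ℕ} {A : Matrix (Fin d) (Fin d) ℤ} {X : Matrix (Fin d) (Fin r) ℤ}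
  {Y : Matrix (Fin r) (Fin d) ℤ} {c : Fin r → ℝ}

/-- The lattice is stable under `A`, and `X * Y` fixes it pointwise. -/
lemma mul_eq (F : IsPositiveFrame A X Y c) : A * X = X * (Y * A * X) := by
  refine ext_of_mulVec_single fun j => ?_
  simp only [← mulVec_mulVec]
  exact (F.right_inv _ (mulVec_mem_eventualLattice (F.mem _))).symm

lemma det_ne_zero (F : IsPositiveFrame A X Y c) : (Y * A * X).det ≠ 0 := by
  intro h0
  obtain ⟨m, hm0, hm⟩ := exists_mulVec_eq_zero_iff.2 h0
  have h1 : A *ᵥ (X *ᵥ m) = 0 := by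
    rw [mulVec_mulVec, F.mul_eq, ← mulVec_mulVec, hm, mulVec_zero]
  have h2 : (fun i => ((X *ᵥ m) i : ℚ)) = 0 :=
    eq_zero_of_pow_mulVec_eq_zero (A := A) (k := 1) (F.mem m) (by
      rw [ratMatrix_pow_mulVec_intCast, pow_one, h1]
      ext i
      simp)
  have h3 : X *ᵥ m = 0 := by
    ext i
    exact Int.cast_eq_zero.1 (congrFun h2 i)
  apply hm0
  rw [← one_mulVec m, ← F.left_inv, ← mulVec_mulVec, h3, mulVec_zero]

lemma pow_mulVec_eq_zero (F : IsPositiveFrame A X Y c) {k : ℕ} {m : Fin r → ℤ}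
    (h : (Y * A * X) ^ k *ᵥ m = 0) : m = 0 := by
  by_contra hm
  have h1 := exists_mulVec_eq_zero_iff.1 ⟨m, hm, h⟩
  rw [det_pow] at h1
  exact pow_ne_zero k F.det_ne_zero h1

/-- Nonnegativity persists under `A ≥ 0`, so the finitely many exponents have a common bound. -/
lemma exists_pow_mul_nonneg (F : IsPositiveFrame A X Y c) (hA : ∀ i j, 0 ≤ A i j) :
    ∃ K : ℕ, ∀ n ≥ K, ∀ (i : Fin d) (l : Fin r), 0 ≤ (A ^ n * X) i l := by
  have h1 : ∀ᶠ n : ℕ in atTop, ∀ (l : Fin r) (i : Fin d), 0 ≤ (A ^ n * X) i l := by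
    refine eventually_all.2 fun l => ?_
    obtain ⟨k, hk⟩ := F.nonneg l
    filter_upwards [eventually_ge_atTop k] with n hn i
    rw [← Nat.sub_add_cancel hn, pow_add, Matrix.mul_assoc, Matrix.mul_apply]
    exact Finset.sum_nonneg fun j _ => mul_nonneg (pow_apply_nonneg hA _ i j) (hk j)
  obtain ⟨K, hK⟩ := eventually_atTop.1 h1
  exact ⟨K, fun n hn i l => hK n hn l i⟩

/-- In the coordinates of a positive frame, positive elements become eventually positive. -/
lemma eventually_pos (F : IsPositiveFrame A X Y c) (hA : A.IsPrimitive) {m : Fin r → ℤ}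
    (hm : m ≠ 0) {k : ℕ} (hk : ∀ i, 0 ≤ (A ^ k *ᵥ (X *ᵥ m)) i) :
    ∀ᶠ n in atTop, ∀ l, 0 < ((Y * A * X) ^ n *ᵥ m) l := by
  have hB : ∀ n, Y *ᵥ (A ^ n *ᵥ (X *ᵥ m)) = (Y * A * X) ^ n *ᵥ m := by
    intro n
    rw [mulVec_mulVec _ (A ^ n), pow_mul_eq_mul_pow F.mul_eq, mulVec_mulVec, ← Matrix.mul_assoc, F.left_inv,
      Matrix.one_mul]
  have hz0 : A ^ k *ᵥ (X *ᵥ m) ≠ 0 := fun h0 => hm <| F.pow_mulVec_eq_zero (k := k) <| by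
    rw [← hB, h0, mulVec_zero]
  obtain ⟨t, ht, a, ha, hlim⟩ := exists_tendsto_pow_mulVec_intCast hA F.perron hk hz0
  have key : ∀ l, ∀ᶠ n in atTop, 0 < ((Y * A * X) ^ (n + k) *ᵥ m) l := by
    intro l
    -- Applying `Y` to the limit `a • X c` gives coordinates `a * c l`.
    refine eventually_pos_of_tendsto ht (mul_pos ha (F.coeff_pos l)) ?_
    have h1 := tendsto_finsetSum Finset.univ fun i _ => (hlim i).const_mul (Y l i : ℝ)
    have h2 : ∑ i, (Y l i : ℝ) * (a * (X.map (fun a : ℤ => (a : ℝ)) *ᵥ c) i) = a * c l := by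
      have h3 : Y.map (fun a : ℤ => (a : ℝ)) *ᵥ (X.map (fun a : ℤ => (a : ℝ)) *ᵥ c) = c := by
        rw [mulVec_mulVec, ← map_intCast_mul, F.left_inv, map_intCast_one, one_mulVec]
      conv_rhs => rw [← congrFun h3 l]
      simp only [mulVec, dotProduct, Matrix.map_apply, Finset.mul_sum]
      refine Finset.sum_congr rfl fun i _ => Finset.sum_congr rfl fun j _ => by ring
    rw [h2] at h1
    refine h1.congr fun n => ?_
    rw [← hB, pow_add, ← mulVec_mulVec]
    simp only [mulVec, dotProduct, Int.cast_sum, Int.cast_mul, Finset.mul_sum]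
    refine Finset.sum_congr rfl fun i _ => ?_
    simp only [← Finset.mul_sum]
    ring
  obtain ⟨K, hK⟩ := eventually_atTop.1 (eventually_all.2 key)
  filter_upwards [eventually_ge_atTop (K + k)] with n hn l
  have := hK (n - k) (by omega) l
  rwa [Nat.sub_add_cancel (by omega)] at this

lemma exists_pow_pos (F : IsPositiveFrame A X Y c) (hA : A.IsPrimitive) :
    ∃ N > 0, ∀ i j, 0 < ((Y * A * X) ^ N) i j := by
  have h1 : ∀ᶠ n in atTop, ∀ j, ∀ i, 0 < ((Y * A * X) ^ n *ᵥ Pi.single j 1) i := by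
    refine eventually_all.2 fun j => ?_
    obtain ⟨k, hk⟩ := F.nonneg j
    refine F.eventually_pos hA (Pi.single_ne_zero_iff.2 one_ne_zero) (k := k) fun i => ?_
    rw [mulVec_mulVec, mulVec_single_one]
    exact hk i
  obtain ⟨N, hN, hN0⟩ := (h1.and (eventually_gt_atTop 0)).exists
  refine ⟨N, hN0, fun i j => ?_⟩
  have := hN j i
  rwa [mulVec_single_one] at this

end IsPositiveFrame

/-! ### Maps between dimension groups -/

lemma ratMatrix_pow_pow {d : ℕ} (B : Matrix (Fin d) (Fin d) ℤ) (N k : ℕ) :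
    ratMatrix (B ^ N) ^ k = ratMatrix B ^ (N * k) := by
  rw [ratMatrix_pow, ← pow_mul]

lemma orderIsomorphic_of_bijective {d n : ℕ} {A : Matrix (Fin d) (Fin d) ℤ}
    {B : Matrix (Fin n) (Fin n) ℤ} (f : dimensionGroup A →+ dimensionGroup B)
    (hf : Function.Bijective f) (h : ∀ g, IsNonneg A g ↔ IsNonneg B (f g)) :
    OrderIsomorphic A B :=
  ⟨AddEquiv.ofBijective f hf, h⟩

lemma OrderIsomorphic.symm {d n : ℕ} {A : Matrix (Fin d) (Fin d) ℤ}
    {B : Matrix (Fin n) (Fin n) ℤ} (h : OrderIsomorphic A B) : OrderIsomorphic B A := by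
  obtain ⟨e, he⟩ := h
  exact ⟨e.symm, fun g => by rw [he, e.apply_symm_apply]⟩

/-- Restriction of an integer matrix `T` that maps `dimensionGroup A` to `dimensionGroup B`. -/
def dimensionGroupMap {d n : ℕ} {A : Matrix (Fin d) (Fin d) ℤ} {B : Matrix (Fin n) (Fin n) ℤ}
    (T : Matrix (Fin n) (Fin d) ℤ)
    (h : ∀ g ∈ dimensionGroup A, T.map (fun a : ℤ => (a : ℚ)) *ᵥ g ∈ dimensionGroup B) :
    dimensionGroup A →+ dimensionGroup B where
  toFun g := ⟨T.map (fun a : ℤ => (a : ℚ)) *ᵥ g, h g g.2⟩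
  map_zero' := Subtype.ext (mulVec_zero (T.map fun a : ℤ => (a : ℚ)))
  map_add' x y := Subtype.ext (mulVec_add _ (x : Fin d → ℚ) y)

section Intertwining

variable {d r : ℕ} {A : Matrix (Fin d) (Fin d) ℤ} {B : Matrix (Fin r) (Fin r) ℤ}
  {X : Matrix (Fin d) (Fin r) ℤ}

lemma ratMatrix_pow_mulVec_mulVec (h : A * X = X * B) (k : ℕ) (q : Fin r → ℚ) :
    ratMatrix A ^ k *ᵥ (X.map (fun a : ℤ => (a : ℚ)) *ᵥ q) =
      X.map (fun a : ℤ => (a : ℚ)) *ᵥ (ratMatrix B ^ k *ᵥ q) := by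
  have h1 : ratMatrix A * X.map (fun a : ℤ => (a : ℚ)) =
      X.map (fun a : ℤ => (a : ℚ)) * ratMatrix B := by
    rw [← map_intCast_mul, ← map_intCast_mul, h]
  rw [mulVec_mulVec, pow_mul_eq_mul_pow h1, mulVec_mulVec]

end Intertwining

/-! ### The two order isomorphisms -/

namespace IsPositiveFrame

variable {d r : ℕ} {A : Matrix (Fin d) (Fin d) ℤ} {X : Matrix (Fin d) (Fin r) ℤ}
  {Y : Matrix (Fin r) (Fin d) ℤ} {c : Fin r → ℝ}

/-- The isomorphism is multiplication by `X`, from right to left. Exponent `k` for the `N`-th power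
corresponds to `N * k` for `A`. -/
theorem orderIsomorphic (F : IsPositiveFrame A X Y c) (hA : A.IsPrimitive) {N : ℕ} (hN : 0 < N) :
    OrderIsomorphic A ((Y * A * X) ^ N) := by
  have hdet := F.det_ne_zero
  have hAX := F.mul_eq
  set B := Y * A * X with hB
  have hk : ∀ k, k ≤ N * k := fun k => Nat.le_mul_of_pos_left k hN
  have hYX : ∀ q : Fin r → ℚ, Y.map (fun a : ℤ => (a : ℚ)) *ᵥ
      (X.map (fun a : ℤ => (a : ℚ)) *ᵥ q) = q := fun q => by
    rw [mulVec_mulVec, ← map_intCast_mul, F.left_inv, map_intCast_one, one_mulVec]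
  have hrange : ∀ q, X.map (fun a : ℤ => (a : ℚ)) *ᵥ q ∈ eventualRange A := by
    intro q
    obtain ⟨q', rfl⟩ := exists_pow_mulVec_eq hdet d q
    rw [← ratMatrix_pow_mulVec_mulVec hAX]
    exact pow_mulVec_mem_eventualRange _
  refine (orderIsomorphic_of_bijective (dimensionGroupMap X ?_) ⟨?_, ?_⟩ fun h => ?_).symm
  · rintro h ⟨-, k, m, hm⟩
    refine ⟨hrange h, N * k, X *ᵥ m, ?_⟩
    rw [ratMatrix_pow_pow] at hm
    rw [ratMatrix_pow_mulVec_mulVec hAX, hm, map_intCast_mulVec]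
  · intro h h' heq
    have h1 := congrArg (fun g : dimensionGroup A => Y.map (fun a : ℤ => (a : ℚ)) *ᵥ (g : Fin d → ℚ)) heq
    exact Subtype.ext ((hYX h).symm.trans (h1.trans (hYX h')))
  · rintro ⟨g, hg, k, z, hz⟩
    have hz' := ratMatrix_pow_mulVec_of_le hz (hk k)
    set z' := A ^ (N * k - k) *ᵥ z
    have hz'mem : z' ∈ eventualLattice A := by
      change (fun i => (z' i : ℚ)) ∈ eventualRange A
      rw [← hz']
      exact mulVec_mem_eventualRange hg _
    -- The preimage is found after `N * k` steps, where the vector is integral. Injectivity of `A`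
    -- on the eventual range brings the equality back to `g`.
    obtain ⟨h, hh⟩ := exists_pow_mulVec_eq hdet (N * k) fun l => ((Y *ᵥ z') l : ℚ)
    refine ⟨⟨h, mem_eventualRange_of_det_ne_zero (by rw [det_pow]; exact pow_ne_zero N hdet) h,
      k, Y *ᵥ z', by rw [ratMatrix_pow_pow, hh]⟩, Subtype.ext ?_⟩
    change X.map (fun a : ℤ => (a : ℚ)) *ᵥ h = g
    refine sub_eq_zero.1 (eq_zero_of_pow_mulVec_eq_zero (A := A) (k := N * k)
      ((eventualRange A).sub_mem (hrange h) hg) ?_)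
    rw [mulVec_sub, ratMatrix_pow_mulVec_mulVec hAX, hh, hz', map_intCast_mulVec,
      F.right_inv z' hz'mem, sub_self]
  · rw [isNonneg_iff, isNonneg_iff]
    constructor
    · rintro ⟨k, m, hm0, hm⟩
      obtain ⟨K, hK⟩ := F.exists_pow_mul_nonneg hA.nonneg
      rw [ratMatrix_pow_pow] at hm
      refine ⟨K + N * k, (A ^ K * X) *ᵥ m, mulVec_nonneg (hK K le_rfl) hm0, ?_⟩
      change ratMatrix A ^ (K + N * k) *ᵥ (X.map (fun a : ℤ => (a : ℚ)) *ᵥ (h : Fin r → ℚ)) = _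
      rw [pow_add, ← mulVec_mulVec, ratMatrix_pow_mulVec_mulVec hAX, hm, map_intCast_mulVec,
        ratMatrix_pow_mulVec_intCast, mulVec_mulVec]
    · rintro ⟨k, m, hm0, hm⟩
      change ratMatrix A ^ k *ᵥ (X.map (fun a : ℤ => (a : ℚ)) *ᵥ (h : Fin r → ℚ)) = _ at hm
      rw [ratMatrix_pow_mulVec_mulVec hAX] at hm
      have hp : ratMatrix B ^ k *ᵥ (h : Fin r → ℚ) = fun l => ((Y *ᵥ m) l : ℚ) := by
        rw [← map_intCast_mulVec, ← hm, hYX]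
      have hXp : X *ᵥ (Y *ᵥ m) = m := intCast_comp_injective <| by
        rw [← map_intCast_mulVec, ← hp, hm]
      by_cases hp0 : Y *ᵥ m = 0
      · refine ⟨k, 0, fun _ => le_rfl, ?_⟩
        rw [ratMatrix_pow_pow, ratMatrix_pow_mulVec_of_le hp (hk k), hp0, mulVec_zero]
      · have hev := F.eventually_pos hA hp0 (k := 0) fun i => by
          rw [hXp, pow_zero, one_mulVec]
          exact hm0 i
        obtain ⟨K, hK⟩ := eventually_atTop.1 hev
        have h1 := hk (K + k)
        refine ⟨K + k, B ^ (N * (K + k) - k) *ᵥ (Y *ᵥ m), fun i => (hK _ (by omega) i).le, ?_⟩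
        rw [ratMatrix_pow_pow, ratMatrix_pow_mulVec_of_le hp (by omega)]

/-- Here `Xᵀ` intertwines `A` with `(Y * Aᵀ * X)ᵀ`, and its kernel is killed by `A ^ d`. -/
theorem orderIsomorphic_transpose (F : IsPositiveFrame Aᵀ X Y c) (hA : A.IsPrimitive) {N : ℕ}
    (hN : 0 < N) (hpos : ∀ i j, 0 ≤ ((Y * Aᵀ * X)ᵀ ^ N) i j) :
    OrderIsomorphic A ((Y * Aᵀ * X)ᵀ ^ N) := by
  have hdet : (Y * Aᵀ * X)ᵀ.det ≠ 0 := by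
    rw [det_transpose]
    exact F.det_ne_zero
  have hTA : (Y * Aᵀ * X)ᵀ * Xᵀ = Xᵀ * A := by
    rw [← transpose_mul, ← F.mul_eq, transpose_mul, transpose_transpose]
  have hTY : Xᵀ * Yᵀ = 1 := by
    rw [← transpose_mul, F.left_inv, transpose_one]
  have hker : A ^ d = A ^ d * Yᵀ * Xᵀ := by
    have h1 : X * (Y * Aᵀ ^ d) = Aᵀ ^ d := by
      refine ext_of_mulVec_single fun j => ?_
      simp only [← mulVec_mulVec]
      exact F.right_inv _ (pow_mulVec_mem_eventualLattice _)
    have h2 := congrArg transpose h1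
    rw [transpose_mul, transpose_mul, ← transpose_pow, transpose_transpose] at h2
    exact h2.symm
  set B := (Y * Aᵀ * X)ᵀ with hB
  have hk : ∀ k, k ≤ N * k := fun k => Nat.le_mul_of_pos_left k hN
  have hker' : ∀ q : Fin d → ℚ, Xᵀ.map (fun a : ℤ => (a : ℚ)) *ᵥ q = 0 →
      ratMatrix A ^ d *ᵥ q = 0 := by
    intro q hq
    rw [← ratMatrix_pow, hker, ratMatrix, map_intCast_mul, ← mulVec_mulVec, hq, mulVec_zero]
  refine orderIsomorphic_of_bijective (dimensionGroupMap Xᵀ ?_) ⟨?_, ?_⟩ fun g => ?_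
  · rintro g ⟨-, k, m, hm⟩
    refine ⟨mem_eventualRange_of_det_ne_zero (by rw [det_pow]; exact pow_ne_zero N hdet) _, k,
      Xᵀ *ᵥ (A ^ (N * k - k) *ᵥ m), ?_⟩
    rw [ratMatrix_pow_pow, ratMatrix_pow_mulVec_mulVec hTA,
      ratMatrix_pow_mulVec_of_le hm (hk k), map_intCast_mulVec]
  · refine (injective_iff_map_eq_zero _).2 fun g hg => Subtype.ext ?_
    exact eq_zero_of_pow_mulVec_eq_zero g.2.1 (hker' _ (congrArg Subtype.val hg))
  · rintro ⟨h, -, k, m, hm⟩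
    -- `Yᵀ` is a right inverse of `Xᵀ` but need not land in the eventual range. Pulling `h` back `d`
    -- steps leaves room to apply `A ^ d`.
    obtain ⟨h', hh'⟩ := exists_pow_mulVec_eq hdet d h
    rw [ratMatrix_pow_pow] at hm
    have hTg : Xᵀ.map (fun a : ℤ => (a : ℚ)) *ᵥ
        (ratMatrix A ^ d *ᵥ (Yᵀ.map (fun a : ℤ => (a : ℚ)) *ᵥ h')) = h := by
      rw [← ratMatrix_pow_mulVec_mulVec hTA, mulVec_mulVec h', ← map_intCast_mul, hTY,
        map_intCast_one, one_mulVec, hh']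
    set g := ratMatrix A ^ d *ᵥ (Yᵀ.map (fun a : ℤ => (a : ℚ)) *ᵥ h') with hg
    refine ⟨⟨g, pow_mulVec_mem_eventualRange _, d + N * k, A ^ d *ᵥ (Yᵀ *ᵥ m), ?_⟩,
      Subtype.ext hTg⟩
    have h1 : Xᵀ.map (fun a : ℤ => (a : ℚ)) *ᵥ
        (ratMatrix A ^ (N * k) *ᵥ g - fun i => ((Yᵀ *ᵥ m) i : ℚ)) = 0 := by
      rw [mulVec_sub, ← ratMatrix_pow_mulVec_mulVec hTA, hTg, hm, map_intCast_mulVec,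
        mulVec_mulVec, hTY, one_mulVec, sub_self]
    have h2 := hker' _ h1
    rw [mulVec_sub, sub_eq_zero, ratMatrix_pow_mulVec_intCast, mulVec_mulVec, ← pow_add] at h2
    exact h2
  · rw [isNonneg_iff, isNonneg_iff]
    constructor
    · rintro ⟨k, m, hm0, hm⟩
      obtain ⟨K, hK⟩ := F.exists_pow_mul_nonneg (isPrimitive_transpose hA).nonneg
      have h1 := hk (K + k)
      have hXA : ∀ l i, 0 ≤ (Xᵀ * A ^ (N * (K + k) - k)) l i := by
        intro l i
        have h2 := hK (N * (K + k) - k) (by omega) i l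
        rwa [← transpose_apply (_ * X), transpose_mul, ← transpose_pow, transpose_transpose] at h2
      refine ⟨K + k, _, mulVec_nonneg hXA hm0, ?_⟩
      change ratMatrix _ ^ (K + k) *ᵥ (Xᵀ.map (fun a : ℤ => (a : ℚ)) *ᵥ (g : Fin d → ℚ)) = _
      rw [ratMatrix_pow_pow, ratMatrix_pow_mulVec_mulVec hTA,
        ratMatrix_pow_mulVec_of_le hm (by omega), map_intCast_mulVec, mulVec_mulVec]
    · rintro ⟨k, p, hp0, hp⟩
      obtain ⟨g, hg, s, z, hz⟩ := g
      change ratMatrix _ ^ k *ᵥ (Xᵀ.map (fun a : ℤ => (a : ℚ)) *ᵥ g) = _ at hp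
      rw [ratMatrix_pow_pow] at hp
      -- This exponent makes the image of `g` integral. It exceeds `N * k` by a multiple of `N`, as
      -- needed because only the `N`-th power of `B` is known to be nonnegative.
      have hsn : s ≤ N * k + N * s := (hk s).trans (Nat.le_add_left _ _)
      have hζ := ratMatrix_pow_mulVec_of_le hz hsn
      set ζ := A ^ (N * k + N * s - s) *ᵥ z
      have hTζ : Xᵀ *ᵥ ζ = B ^ (N * s) *ᵥ p := intCast_comp_injective <| by
        rw [← map_intCast_mulVec, ← hζ, ← ratMatrix_pow_mulVec_mulVec hTA,
          ratMatrix_pow_mulVec_of_le hp (Nat.le_add_right _ _), Nat.add_sub_cancel_left]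
      have hTζ0 : ∀ l, 0 ≤ (Xᵀ *ᵥ ζ) l := by
        rw [hTζ, pow_mul]
        exact mulVec_nonneg (pow_apply_nonneg hpos s) hp0
      by_cases h0 : Xᵀ *ᵥ ζ = 0
      · refine ⟨d + (N * k + N * s), 0, fun _ => le_rfl, ?_⟩
        rw [pow_add, ← mulVec_mulVec, hζ, ratMatrix_pow_mulVec_intCast, hker, ← mulVec_mulVec, h0,
          mulVec_zero]
      -- The pairing of `X c` with `ζ` equals that of `c > 0` with the nonzero nonnegative vector
      -- `Xᵀ ζ`.
      · have hsum : 0 < ∑ j, (X.map (fun a : ℤ => (a : ℝ)) *ᵥ c) j * (ζ j : ℝ) := by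
          have h1 : ∑ j, (X.map (fun a : ℤ => (a : ℝ)) *ᵥ c) j * (ζ j : ℝ) =
              ∑ l, c l * ((Xᵀ *ᵥ ζ) l : ℝ) := by
            simp only [mulVec, dotProduct, Matrix.map_apply, transpose_apply, Int.cast_sum,
              Int.cast_mul, Finset.mul_sum, Finset.sum_mul]
            rw [Finset.sum_comm]
            exact Finset.sum_congr rfl fun l _ => Finset.sum_congr rfl fun j _ => by ring
          obtain ⟨l, hl⟩ := Function.ne_iff.1 h0
          rw [h1]
          exact Finset.sum_pos'
            (fun l _ => mul_nonneg (F.coeff_pos l).le (Int.cast_nonneg (hTζ0 l)))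
            ⟨l, Finset.mem_univ l, mul_pos (F.coeff_pos l)
              (Int.cast_pos.2 (lt_of_le_of_ne (hTζ0 l) (Ne.symm hl)))⟩
        obtain ⟨n, hn⟩ := (eventually_pos_pow_mulVec hA F.perron hsum).exists
        refine ⟨n + (N * k + N * s), A ^ n *ᵥ ζ, fun i => (hn i).le, ?_⟩
        rw [pow_add, ← mulVec_mulVec, hζ, ratMatrix_pow_mulVec_intCast]

end IsPositiveFrame

end StationaryDimensionGroup

open StationaryDimensionGroup in
theorem theorem10p3 {d : ℕ} (A : Matrix (Fin d) (Fin d) ℤ) (hA : A.IsPrimitive)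
    (hcone : StationaryDimensionGroup.HasPositiveUnimodularCone A ∨
      StationaryDimensionGroup.HasPositiveUnimodularCone A.transpose) :
    ∃ (n : ℕ) (B : Matrix (Fin n) (Fin n) ℤ), B.IsPrimitive ∧ B.det ≠ 0 ∧
      StationaryDimensionGroup.OrderIsomorphic A B := by
  rcases hcone with h | h
  · obtain ⟨r, X, Y, c, F⟩ := h.exists_isPositiveFrame
    obtain ⟨N, hN, hpos⟩ := F.exists_pow_pos hA
    refine ⟨r, (Y * A * X) ^ N, ⟨fun i j => (hpos i j).le, 1, one_pos, ?_⟩, ?_,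
      F.orderIsomorphic hA hN⟩
    · rwa [pow_one]
    · rw [Matrix.det_pow]
      exact pow_ne_zero N F.det_ne_zero
  · obtain ⟨r, X, Y, c, F⟩ := h.exists_isPositiveFrame
    obtain ⟨N, hN, hpos⟩ := F.exists_pow_pos (isPrimitive_transpose hA)
    have hpos' : ∀ i j, 0 < ((Y * A.transpose * X).transpose ^ N) i j := fun i j => by
      rw [← Matrix.transpose_pow]
      exact hpos j i
    refine ⟨r, (Y * A.transpose * X).transpose ^ N, ⟨fun i j => (hpos' i j).le, 1, one_pos, ?_⟩,
      ?_, F.orderIsomorphic_transpose hA hN fun i j => (hpos' i j).le⟩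
    · rwa [pow_one]
    · rw [Matrix.det_pow, Matrix.det_transpose]
      exact pow_ne_zero N F.det_ne_zero
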